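/- A \emph{$\mathcal C^\infty$-ring} is a set $A$ together with an operation $A^n\to A$ for every $n\ge 0$ and every smooth function $f:\mathbb R^n\to\mathbb R$, such that projections are interpreted as projections and composites $h\circ(g_1,\dots,g_n)$ as composites; a \emph{$\mathcal C^\infty$-homomorphism} is a map commuting with all these operations. Every $\mathcal C^\infty$-ring has an underlying commutative unital ring; it is a \emph{$\mathcal C^\infty$-field}, respectively \emph{von Neumann regular}, if this ring is a field, respectively satisfies $\forall a\,\exists x\; a=a^2x$. Let $\mathcal C^\infty\mathbf{vNRing}$ be the category of von Neumann regular $\mathcal C^\infty$-rings and $\mathcal C^\infty$-homomorphisms, $\mathbf{BA}$ the category of Boolean algebras, and $\mathbf{BoolSp}$ the category of Boolean (compact, Hausdorff, totally disconnected) spaces and continuous maps. Let $\widetilde B:\mathcal C^\infty\mathbf{vNRing}\to\mathbf{BA}$ send $A$ to the Boolean algebra of idempotents of its underlying ring (with $e\wedge e'=ee'$, $e\vee e'=e+e'-ee'$, $e^*=1-e$) and a homomorphism to its restriction. Let $\mathrm{Stone}:\mathbf{BA}\to\mathbf{BoolSp}$ be the contravariant functor sending a Boolean algebra to its space of ultrafilters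 and a homomorphism to the preimage map. Let $\mathbb K$ be a $\mathcal C^\infty$-field. Let $\widehat k:\mathbf{BoolSp}\to\mathcal C^\infty\mathbf{vNRing}$ be the contravariant functor sending $X$ to the directed colimit $$A_X=\varinjlim_{R}\mathbb K^{X/R}$$ of $\mathcal C^\infty$-rings, over all equivalence relations $R$ on $X$ such that $X/R$ is discrete and compact (finer relations being larger), with $\mathbb K^{X/R}$ carrying the coordinatewise operations, and sending a continuous map $g:X\to Y$ to the homomorphism $A_Y\to A_X$ induced by the maps $\mathbb K^{Y/R}\to\mathbb K^{X/(g\times g)^{-1}[R]}$ of precomposition with $X/(g\times g)^{-1}[R]\to Y/R$. Let $\check K=\widehat k\circ\mathrm{Stone}:\mathbf{BA}\to\mathcal C^\infty\mathbf{vNRing}$, a covariant functor. Then there is a natural isomorphism $\theta:\mathrm{Id}_{\mathbf{BA}}\cong\widetilde B\circ\check K$; in particular $h=\theta_{B'}^{-1}\circ\widetilde B(\check K(h))\circ\theta_B$ for every homomorphism $h:B\to B'$ of Boolean algebras. Consequently: \begin{itemize} \item the functor $\check K$ is faithful; \item the functor $\widetilde B$ is full up to conjugation: for every homomorphism $\varphi:B\to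 B'$ of Boolean algebras there are a $\mathcal C^\infty$-homomorphism $f:A\to A'$ of von Neumann regular $\mathcal C^\infty$-rings and isomorphisms $\psi:B\to\widetilde B(A)$, $\psi':B'\to\widetilde B(A')$ with $\varphi=\psi'^{-1}\circ\widetilde B(f)\circ\psi$; \item the functor $\widetilde B$ is isomorphism-dense (every Boolean algebra is isomorphic to some $\widetilde B(A)$). In particular, for every Boolean algebra $B$, $\check K(B)$ is a von Neumann regular $\mathcal C^\infty$-ring, it is a $\mathbb K$-algebra by the $\mathcal C^\infty$-homomorphism $\mathbb K\to\check K(B)$ sending $c$ to the class of the constant functions with value $c$, this structure is natural in $B$, and $\widetilde B(\check K(B))\cong B$. \end{itemize} -/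

import Mathlib

open CategoryTheory
open scoped ContDiff

universe u

noncomputable section

/-! ### Smooth functions and `C^∞`-rings -/

/-- The set `C^∞(ℝⁿ, ℝ)` of smooth real functions of `n` variables. -/
abbrev SmoothFun (n : ℕ) : Type :=
  {f : (Fin n → ℝ) → ℝ // ContDiff ℝ ∞ f}

namespace SmoothFun

/-- The `k`-th projection `ℝⁿ → ℝ`. -/
def proj {n : ℕ} (k : Fin n) : SmoothFun n :=
  ⟨fun v => v k, by fun_prop⟩

/-- The composite `h ∘ (g₁, …, gₙ)`. -/
def comp {m n : ℕ} (h : SmoothFun n) (g : Fin n → SmoothFun m) : SmoothFun m :=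
  ⟨fun v => h.1 fun i => (g i).1 v, h.2.comp (contDiff_pi.2 fun i => (g i).2)⟩

/-- Constants, as functions of `0` variables. -/
def const (c : ℝ) : SmoothFun 0 := ⟨fun _ => c, contDiff_const⟩

/-- The addition `ℝ² → ℝ`. -/
def add : SmoothFun 2 := ⟨fun v => v 0 + v 1, by fun_prop⟩

/-- The multiplication `ℝ² → ℝ`. -/
def mul : SmoothFun 2 := ⟨fun v => v 0 * v 1, by fun_prop⟩

/-- The negation `ℝ → ℝ`. -/
def neg : SmoothFun 1 := ⟨fun v => -v 0, by fun_prop⟩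

end SmoothFun

/-- A `C^∞`-ring structure on a set `A`: every smooth function `f : ℝⁿ → ℝ` is interpreted as an
`n`-ary operation on `A`, compatibly with projections and with composition. -/
class CInfRing (A : Type u) where
  /-- The interpretation of a smooth function. -/
  op : ∀ {n : ℕ}, SmoothFun n → (Fin n → A) → A
  op_proj : ∀ {n : ℕ} (k : Fin n) (x : Fin n → A), op (SmoothFun.proj k) x = x k
  op_comp : ∀ {m n : ℕ} (h : SmoothFun n) (g : Fin n → SmoothFun m) (x : Fin m → A),
    op (h.comp g) x = op h fun i => op (g i) x

/-- A `C^∞`-homomorphism: a map commuting with the interpretations of all smooth functions. -/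
@[ext]
structure CInfHom (A B : Type u) [CInfRing A] [CInfRing B] where
  toFun : A → B
  map_op : ∀ {n : ℕ} (f : SmoothFun n) (x : Fin n → A),
    toFun (CInfRing.op f x) = CInfRing.op f fun i => toFun (x i)

namespace CInfHom

instance (A B : Type u) [CInfRing A] [CInfRing B] : FunLike (CInfHom A B) A B where
  coe := toFun
  coe_injective f g h := by cases f; cases g; congr

/-- The identity. -/
def id (A : Type u) [CInfRing A] : CInfHom A A := ⟨fun a => a, fun _ _ => rfl⟩

/-- The composite `g ∘ f`. -/
def comp {A B C : Type u} [CInfRing A] [CInfRing B] [CInfRing C]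
    (g : CInfHom B C) (f : CInfHom A B) : CInfHom A C :=
  ⟨fun a => g.toFun (f.toFun a), fun p x => by rw [f.map_op, g.map_op]⟩

end CInfHom

namespace CInfRing

variable {A : Type u} [CInfRing A]

def addOp (x y : A) : A := op SmoothFun.add ![x, y]
def mulOp (x y : A) : A := op SmoothFun.mul ![x, y]
def negOp (x : A) : A := op SmoothFun.neg ![x]
def constOp (A : Type u) [CInfRing A] (c : ℝ) : A := op (SmoothFun.const c) ![]

theorem addOp_op {n : ℕ} (f g : SmoothFun n) (z : Fin n → A) :
    addOp (op f z) (op g z) = op ⟨fun v => f.1 v + g.1 v, f.2.add g.2⟩ z := by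
  have := op_comp SmoothFun.add ![f, g] z
  rw [addOp, show (![op f z, op g z] : Fin 2 → A) = fun i => op ((![f, g] : Fin 2 → _) i) z by
    funext i; fin_cases i <;> rfl, ← this]
  rfl

theorem mulOp_op {n : ℕ} (f g : SmoothFun n) (z : Fin n → A) :
    mulOp (op f z) (op g z) = op ⟨fun v => f.1 v * g.1 v, f.2.mul g.2⟩ z := by
  have := op_comp SmoothFun.mul ![f, g] z
  rw [mulOp, show (![op f z, op g z] : Fin 2 → A) = fun i => op ((![f, g] : Fin 2 → _) i) z by
    funext i; fin_cases i <;> rfl, ← this]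
  rfl

theorem negOp_op {n : ℕ} (f : SmoothFun n) (z : Fin n → A) :
    negOp (op f z) = op ⟨fun v => -f.1 v, f.2.neg⟩ z := by
  have := op_comp SmoothFun.neg ![f] z
  rw [negOp, show (![op f z] : Fin 1 → A) = fun i => op ((![f] : Fin 1 → _) i) z by
    funext i; fin_cases i; rfl, ← this]
  rfl

theorem constOp_eq {n : ℕ} (c : ℝ) (z : Fin n → A) :
    constOp A c = op ⟨fun _ => c, contDiff_const⟩ z := by
  have := op_comp (SmoothFun.const c) ![] z
  rw [constOp, show (![] : Fin 0 → A) = fun i => op ((![] : Fin 0 → SmoothFun n) i) z from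
    Subsingleton.elim _ _, ← this]
  rfl

theorem exists_op₃ (x y w : A) : ∃ z : Fin 3 → A,
    x = op (SmoothFun.proj 0) z ∧ y = op (SmoothFun.proj 1) z ∧ w = op (SmoothFun.proj 2) z :=
  ⟨![x, y, w], by simp [op_proj]⟩

/-- The underlying commutative unital ring of a `C^∞`-ring: the ring operations are the
interpretations of the smooth functions `x + y`, `x * y`, `-x`, `0` and `1`. -/
abbrev toCommRing (A : Type u) [CInfRing A] : CommRing A where
  add x y := op SmoothFun.add ![x, y]
  mul x y := op SmoothFun.mul ![x, y]
  neg x := op SmoothFun.neg ![x]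
  zero := op (SmoothFun.const 0) ![]
  one := op (SmoothFun.const 1) ![]
  nsmul := @nsmulRec A ⟨op (SmoothFun.const 0) ![]⟩ ⟨fun x y => op SmoothFun.add ![x, y]⟩
  zsmul := @zsmulRec A ⟨op (SmoothFun.const 0) ![]⟩ ⟨fun x y => op SmoothFun.add ![x, y]⟩
    ⟨fun x => op SmoothFun.neg ![x]⟩
    (@nsmulRec A ⟨op (SmoothFun.const 0) ![]⟩ ⟨fun x y => op SmoothFun.add ![x, y]⟩)
  add_assoc x y w := by
    change addOp (addOp x y) w = addOp x (addOp y w)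
    obtain ⟨z, rfl, rfl, rfl⟩ := exists_op₃ x y w
    simp only [addOp_op, add_assoc]
  zero_add x := by
    change addOp (constOp A 0) x = x
    obtain ⟨z, h, -, -⟩ := exists_op₃ x x x
    rw [h]
    simp only [constOp_eq 0 z, addOp_op, zero_add]
  add_zero x := by
    change addOp x (constOp A 0) = x
    obtain ⟨z, h, -, -⟩ := exists_op₃ x x x
    rw [h]
    simp only [constOp_eq 0 z, addOp_op, add_zero]
  add_comm x y := by
    change addOp x y = addOp y x
    obtain ⟨z, rfl, rfl, -⟩ := exists_op₃ x y y
    simp only [addOp_op, add_comm]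
  left_distrib x y w := by
    change mulOp x (addOp y w) = addOp (mulOp x y) (mulOp x w)
    obtain ⟨z, rfl, rfl, rfl⟩ := exists_op₃ x y w
    simp only [addOp_op, mulOp_op, mul_add]
  right_distrib x y w := by
    change mulOp (addOp x y) w = addOp (mulOp x w) (mulOp y w)
    obtain ⟨z, rfl, rfl, rfl⟩ := exists_op₃ x y w
    simp only [addOp_op, mulOp_op, add_mul]
  zero_mul x := by
    change mulOp (constOp A 0) x = constOp A 0
    obtain ⟨z, h, -, -⟩ := exists_op₃ x x x
    rw [h]
    simp only [constOp_eq 0 z, mulOp_op, zero_mul]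
  mul_zero x := by
    change mulOp x (constOp A 0) = constOp A 0
    obtain ⟨z, h, -, -⟩ := exists_op₃ x x x
    rw [h]
    simp only [constOp_eq 0 z, mulOp_op, mul_zero]
  mul_assoc x y w := by
    change mulOp (mulOp x y) w = mulOp x (mulOp y w)
    obtain ⟨z, rfl, rfl, rfl⟩ := exists_op₃ x y w
    simp only [mulOp_op, mul_assoc]
  one_mul x := by
    change mulOp (constOp A 1) x = x
    obtain ⟨z, h, -, -⟩ := exists_op₃ x x x
    rw [h]
    simp only [constOp_eq 1 z, mulOp_op, one_mul]
  mul_one x := by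
    change mulOp x (constOp A 1) = x
    obtain ⟨z, h, -, -⟩ := exists_op₃ x x x
    rw [h]
    simp only [constOp_eq 1 z, mulOp_op, mul_one]
  neg_add_cancel x := by
    change addOp (negOp x) x = constOp A 0
    obtain ⟨z, h, -, -⟩ := exists_op₃ x x x
    rw [h]
    simp only [constOp_eq 0 z, addOp_op, negOp_op, neg_add_cancel]
  mul_comm x y := by
    change mulOp x y = mulOp y x
    obtain ⟨z, rfl, rfl, -⟩ := exists_op₃ x y y
    simp only [mulOp_op, mul_comm]

/-- The product `C^∞`-ring `A^S`: smooth functions act coordinatewise. -/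
instance instPi (S : Type u) (A : Type u) [CInfRing A] : CInfRing (S → A) where
  op f x := fun s => op f fun i => x i s
  op_proj k x := by funext s; rw [op_proj]
  op_comp h g x := by funext s; rw [op_comp]

end CInfRing

/-! ### The category of `C^∞`-rings and its underlying-ring functor -/

/-- The category of `C^∞`-rings. -/
structure CInfRingCat : Type (u + 1) where
  of ::
  carrier : Type u
  [str : CInfRing carrier]

namespace CInfRingCat

instance : CoeSort CInfRingCat.{u} (Type u) := ⟨carrier⟩

attribute [instance] str

instance : Category CInfRingCat.{u} where
  Hom A B := CInfHom A B
  id A := CInfHom.id A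
  comp f g := CInfHom.comp g f

instance (A : CInfRingCat.{u}) : CommRing A := CInfRing.toCommRing A

/-- A `C^∞`-homomorphism is a homomorphism of the underlying rings. -/
def ringHom {A B : CInfRingCat.{u}} (f : A ⟶ B) : A →+* B where
  toFun := CInfHom.toFun f
  map_one' := (CInfHom.map_op f _ _).trans (congrArg _ (Subsingleton.elim _ _))
  map_zero' := (CInfHom.map_op f _ _).trans (congrArg _ (Subsingleton.elim _ _))
  map_add' x y := (CInfHom.map_op f _ _).trans
    (congrArg _ (by funext i; fin_cases i <;> rfl))
  map_mul' x y := (CInfHom.map_op f _ _).trans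
    (congrArg _ (by funext i; fin_cases i <;> rfl))

/-- The forgetful functor from `C^∞`-rings to commutative unital rings. -/
def forgetToCommRing : CInfRingCat.{u} ⥤ CommRingCat.{u} where
  obj A := CommRingCat.of A
  map f := CommRingCat.ofHom (ringHom f)

/-- A `C^∞`-field is a `C^∞`-ring whose underlying ring is a field. -/
def IsCInfField (K : CInfRingCat.{u}) : Prop := IsField K

/-- A `C^∞`-ring is von Neumann regular if its underlying ring is. -/
def IsVNRegular : ObjectProperty CInfRingCat.{u} :=
  fun A => ∀ a : A, ∃ x : A, a = a ^ 2 * x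

end CInfRingCat

/-- The category of von Neumann regular `C^∞`-rings, a full subcategory of `C^∞`-rings. -/
abbrev CInfVNRing : Type (u + 1) := CInfRingCat.IsVNRegular.{u}.FullSubcategory

/-! ### The Boolean algebra of idempotents -/

/-- The functor from commutative rings to Boolean algebras sending `A` to its set of idempotents,
with `e ⊓ e' = e * e'`, `e ⊔ e' = e + e' - e * e'`, `eᶜ = 1 - e`, and `f` to its restriction. -/
def idempotents : CommRingCat.{u} ⥤ BoolAlg.{u} where
  obj A := BoolAlg.of {e : A // IsIdempotentElem e}
  map f := BoolAlg.ofHom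
    { toFun := fun e => ⟨f.hom e.1, e.2.map f.hom⟩
      map_sup' := fun a b => Subtype.ext (by
        change f.hom (a.1 + b.1 - a.1 * b.1) = f.hom a.1 + f.hom b.1 - f.hom a.1 * f.hom b.1
        simp)
      map_inf' := fun a b => Subtype.ext (map_mul f.hom a.1 b.1)
      map_top' := Subtype.ext (map_one f.hom)
      map_bot' := Subtype.ext (map_zero f.hom) }

/-- The functor `B̃` from von Neumann regular `C^∞`-rings to Boolean algebras: the Boolean algebra
of idempotents of the underlying ring. -/
def idempotentsVN : CInfVNRing.{u} ⥤ BoolAlg.{u} :=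
  CInfRingCat.IsVNRegular.ι ⋙ CInfRingCat.forgetToCommRing ⋙ idempotents

/-! ### The Stone space functor -/

/-- An ultrafilter in a Boolean algebra: a proper filter which contains, for every `a`, either `a`
or its complement (equivalently, a maximal proper filter). -/
@[ext]
structure BoolUltrafilter (B : Type u) [BooleanAlgebra B] where
  carrier : Set B
  top_mem : ⊤ ∈ carrier
  inf_mem : ∀ {a b : B}, a ∈ carrier → b ∈ carrier → a ⊓ b ∈ carrier
  mem_of_le : ∀ {a b : B}, a ≤ b → a ∈ carrier → b ∈ carrier
  bot_notMem : ⊥ ∉ carrier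
  mem_or_compl_mem : ∀ a : B, a ∈ carrier ∨ aᶜ ∈ carrier

namespace BoolUltrafilter

variable {B B' : Type u} [BooleanAlgebra B] [BooleanAlgebra B']

/-- The basic open set of all ultrafilters that contain `b`. -/
def basic (b : B) : Set (BoolUltrafilter B) := {U | b ∈ U.carrier}

theorem compl_mem_iff (U : BoolUltrafilter B) (a : B) : aᶜ ∈ U.carrier ↔ a ∉ U.carrier :=
  ⟨fun h h' => U.bot_notMem (by simpa using U.inf_mem h' h),
    fun h => (U.mem_or_compl_mem a).resolve_left h⟩

/-- The Stone topology, with the sets `basic b` as a basis. -/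
instance : TopologicalSpace (BoolUltrafilter B) :=
  TopologicalSpace.generateFrom (Set.range basic)

theorem isOpen_basic (b : B) : IsOpen (basic b) := .basic _ ⟨b, rfl⟩

theorem isClopen_basic (b : B) : IsClopen (basic b) := by
  refine ⟨⟨?_⟩, isOpen_basic b⟩
  convert isOpen_basic bᶜ using 1
  ext U
  exact (U.compl_mem_iff b).symm

theorem exists_separate {U V : BoolUltrafilter B} (h : U ≠ V) :
    ∃ b, U ∈ basic b ∧ V ∉ basic b := by
  by_contra! hc
  refine h (BoolUltrafilter.ext (Set.Subset.antisymm (fun b hb => hc b hb) fun b hb => ?_))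
  by_contra hb'
  exact (V.compl_mem_iff b).1 (hc bᶜ ((U.compl_mem_iff b).2 hb')) hb

instance : TotallySeparatedSpace (BoolUltrafilter B) where
  isTotallySeparated_univ := by
    intro U _ V _ h
    obtain ⟨b, hU, hV⟩ := exists_separate h
    exact ⟨basic b, (basic b)ᶜ, isOpen_basic b, (isClopen_basic b).compl.isOpen, hU, hV,
      by simp, disjoint_compl_right⟩

instance : T2Space (BoolUltrafilter B) := inferInstance

instance : TotallyDisconnectedSpace (BoolUltrafilter B) := inferInstance

instance : CompactSpace (BoolUltrafilter B) where
  isCompact_univ := by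
    rw [isCompact_iff_ultrafilter_le_nhds]
    intro F _
    refine ⟨⟨{b | basic b ∈ F}, ?_, ?_, ?_, ?_, ?_⟩, trivial, ?_⟩
    · exact Filter.mem_of_superset Filter.univ_mem fun U _ => U.top_mem
    · exact fun ha hb => Filter.mem_of_superset (Filter.inter_mem ha hb)
        fun U hU => U.inf_mem hU.1 hU.2
    · exact fun hab ha => Filter.mem_of_superset ha fun U hU => U.mem_of_le hab hU
    · intro h
      obtain ⟨U, hU⟩ := F.nonempty_of_mem (show basic (⊥ : B) ∈ F from h)
      exact U.bot_notMem hU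
    · intro a
      refine (F.mem_or_compl_mem (basic a)).imp_right fun h => ?_
      exact Filter.mem_of_superset h fun U hU => (U.compl_mem_iff a).2 hU
    · rw [TopologicalSpace.nhds_generateFrom]
      refine le_iInf₂ ?_
      rintro _ ⟨hs, b, rfl⟩
      exact Filter.le_principal_iff.2 hs

/-- The preimage of an ultrafilter under a homomorphism of Boolean algebras. -/
def comap (h : BoundedLatticeHom B B') (U : BoolUltrafilter B') : BoolUltrafilter B where
  carrier := h ⁻¹' U.carrier
  top_mem := by simpa using U.top_mem
  inf_mem ha hb := by simpa using U.inf_mem ha hb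
  mem_of_le hab ha := U.mem_of_le (OrderHomClass.mono h hab) ha
  bot_notMem := by simpa using U.bot_notMem
  mem_or_compl_mem a := by simpa using U.mem_or_compl_mem (h a)

theorem continuous_comap (h : BoundedLatticeHom B B') : Continuous (comap h) := by
  refine continuous_generateFrom_iff.2 ?_
  rintro _ ⟨b, rfl⟩
  exact isOpen_basic (h b)

end BoolUltrafilter

/-- The contravariant Stone space functor from Boolean algebras to Boolean spaces (compact,
Hausdorff, totally disconnected spaces): `B` goes to its space of ultrafilters and a homomorphism
to the preimage map. -/
def stone : BoolAlg.{u} ⥤ Profinite.{u}ᵒᵖ where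
  obj B := Opposite.op (Profinite.of (BoolUltrafilter B))
  map h := Quiver.Hom.op (CompHausLike.ofHom _
    ⟨BoolUltrafilter.comap h.hom, BoolUltrafilter.continuous_comap h.hom⟩)

/-! ### Directed colimits of `C^∞`-rings -/

namespace CInfRing

section DirectLimit

variable {ι : Type u} [Preorder ι] [IsDirectedOrder ι] [Nonempty ι] {F : ι → Type u}
  [∀ i, CInfRing (F i)] (f : ∀ i j, i ≤ j → CInfHom (F i) (F j)) [DirectedSystem F (f · · ·)]

theorem exists_common_rep {n : ℕ} (x : Fin n → DirectLimit F f) :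
    ∃ (i : ι) (y : Fin n → F i), ∀ k, x k = ⟦⟨i, y k⟩⟧ := by
  choose i y h using fun k => DirectLimit.exists_eq_mk f (x k)
  obtain ⟨j, hj⟩ := Finite.exists_le i
  exact ⟨j, fun k => f _ _ (hj k) (y k), fun k => by rw [h k, DirectLimit.mk_apply]⟩

/-- The interpretation of a smooth function in a directed colimit: represent the arguments at a
common stage and interpret the function there. -/
def directLimitOp {n : ℕ} (p : SmoothFun n) (x : Fin n → DirectLimit F f) : DirectLimit F f :=
  ⟦⟨(exists_common_rep f x).choose, op p (exists_common_rep f x).choose_spec.choose⟩⟧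

theorem directLimitOp_mk {n : ℕ} (p : SmoothFun n) (i : ι) (y : Fin n → F i) :
    directLimitOp f p (fun k => (⟦⟨i, y k⟩⟧ : DirectLimit F f)) = ⟦⟨i, op p y⟩⟧ := by
  set x : Fin n → DirectLimit F f := fun k => ⟦⟨i, y k⟩⟧ with hx
  set j := (exists_common_rep f x).choose with hj
  set z : Fin n → F j := (exists_common_rep f x).choose_spec.choose with hz
  have h : ∀ k, (⟦⟨i, y k⟩⟧ : DirectLimit F f) = ⟦⟨j, z k⟩⟧ :=
    (exists_common_rep f x).choose_spec.choose_spec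
  choose m hi hj' hm using fun k => Quotient.exact (h k)
  obtain ⟨l₀, hl₀⟩ := Finite.exists_le m
  obtain ⟨l₁, hil, hjl⟩ := exists_ge_ge i j
  obtain ⟨l, h0, h1⟩ := exists_ge_ge l₀ l₁
  change (⟦⟨j, op p z⟩⟧ : DirectLimit F f) = _
  refine Quotient.sound ⟨l, hjl.trans h1, hil.trans h1, ?_⟩
  refine ((f _ _ _).map_op p z).trans (Eq.trans ?_ ((f _ _ _).map_op p y).symm)
  congr 1
  funext k
  have := congrArg (f _ _ ((hl₀ k).trans h0)) (hm k)
  rw [DirectedSystem.map_map' f, DirectedSystem.map_map' f] at this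
  exact this.symm

/-- The directed colimit of `C^∞`-rings: the colimit of the underlying sets, with the operations
computed at a common stage. -/
instance instDirectLimit : CInfRing (DirectLimit F f) where
  op p x := directLimitOp f p x
  op_proj k x := by
    obtain ⟨i, y, h⟩ := exists_common_rep f x
    obtain rfl : x = fun k => ⟦⟨i, y k⟩⟧ := funext h
    rw [directLimitOp_mk, op_proj]
  op_comp h g x := by
    obtain ⟨i, y, hx⟩ := exists_common_rep f x
    obtain rfl : x = fun k => ⟦⟨i, y k⟩⟧ := funext hx
    simp only [directLimitOp_mk, op_comp]

/-- The canonical `C^∞`-homomorphism from a stage to the directed colimit. -/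
def toDirectLimit (i : ι) : CInfHom (F i) (DirectLimit F f) :=
  ⟨fun y => ⟦⟨i, y⟩⟧, fun p y => (directLimitOp_mk f p i y).symm⟩

/-- The `C^∞`-homomorphism out of a directed colimit induced by a compatible family. -/
def directLimitDesc {C : Type u} [CInfRing C] (g : ∀ i, CInfHom (F i) C)
    (hg : ∀ i j (h : i ≤ j) (x : F i), g i x = g j (f i j h x)) : CInfHom (DirectLimit F f) C :=
  ⟨DirectLimit.lift f (fun i => g i) hg, fun p x => by
    obtain ⟨i, y, hx⟩ := exists_common_rep f x
    obtain rfl : x = fun k => ⟦⟨i, y k⟩⟧ := funext hx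
    exact (congrArg _ (directLimitOp_mk f p i y)).trans ((g i).map_op p y)⟩

end DirectLimit

end CInfRing

/-! ### The functor `k̂` -/

section KHat

variable (K : Type u) [CInfRing K]

/-- The `C^∞`-homomorphism `K^T → K^S` given by precomposition with `g : S → T`. -/
def CInfHom.precomp {S T : Type u} (g : S → T) : CInfHom (T → K) (S → K) :=
  ⟨fun φ => φ ∘ g, fun _ _ => rfl⟩

variable (X : Type u) [TopologicalSpace X]

/-- The `C^∞`-ring `K^(X/R)`, for an equivalence relation `R` on `X` with discrete quotient. The
index set is ordered so that finer relations are larger. -/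
abbrev KHatStage (R : (DiscreteQuotient X)ᵒᵈ) : Type u :=
  Quotient (OrderDual.ofDual R).toSetoid → K

/-- The transition maps `K^(X/R) → K^(X/S)` for `S ⊆ R`, induced by `X/S → X/R`. -/
def kHatTransition (R S : (DiscreteQuotient X)ᵒᵈ) (h : R ≤ S) :
    CInfHom (KHatStage K X R) (KHatStage K X S) :=
  CInfHom.precomp K (DiscreteQuotient.ofLE (OrderDual.ofDual_le_ofDual.2 h))

instance : DirectedSystem (KHatStage K X) (kHatTransition K X · · ·) where
  map_self R φ := by
    funext q
    exact congrArg φ (DiscreteQuotient.ofLE_refl_apply q)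
  map_map R S T hRS hST φ := by
    funext q
    exact congrArg φ (DiscreteQuotient.ofLE_ofLE _ _ q)

/-- The `C^∞`-ring `A_X`, the directed colimit of the `K^(X/R)` over all equivalence relations `R`
on `X` with discrete (and, if `X` is compact, automatically compact) quotient. -/
abbrev KHatRing : Type u := DirectLimit (KHatStage K X) (kHatTransition K X)

variable {X} {Y : Type u} [TopologicalSpace Y]

/-- The map `A_Y → A_X` induced by a continuous map `g : X → Y`: on the stage of `R`, it is
`K^(Y/R) → K^(X/g⁻¹R) → A_X`. -/
def kHatMap (g : C(X, Y)) : CInfHom (KHatRing K Y) (KHatRing K X) :=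
  CInfRing.directLimitDesc (kHatTransition K Y)
    (fun R => (CInfRing.toDirectLimit (kHatTransition K X)
        (OrderDual.toDual ((OrderDual.ofDual R).comap g))).comp
      (CInfHom.precomp K (DiscreteQuotient.map g (A := (OrderDual.ofDual R).comap g)
        (B := OrderDual.ofDual R) le_rfl)))
    (fun R S h φ => by
      refine Quotient.sound ⟨OrderDual.toDual ((OrderDual.ofDual S).comap g),
        OrderDual.toDual_le_toDual.2
          (DiscreteQuotient.comap_mono g (OrderDual.ofDual_le_ofDual.2 h)), le_rfl, ?_⟩
      funext q
      induction q using Quotient.inductionOn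
      rfl)

end KHat

/-! ### Von Neumann regularity of `A_X` and the resulting functors -/

namespace CInfRingCat

theorem IsVNRegular.of_exists {A : CInfRingCat.{u}}
    (h : ∀ a : A, ∃ (C : CInfRingCat.{u}) (f : C ⟶ A), IsVNRegular C ∧ ∃ c, ringHom f c = a) :
    IsVNRegular A := by
  intro a
  obtain ⟨C, f, hC, c, rfl⟩ := h a
  obtain ⟨x, hx⟩ := hC c
  exact ⟨ringHom f x, by rw [← map_pow, ← map_mul, ← hx]⟩

theorem IsVNRegular.of_evals {A K : CInfRingCat.{u}} (hK : IsCInfField K) {S : Type u}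
    (ev : S → (A ⟶ K)) (hsurj : ∀ φ : S → K, ∃ a : A, ∀ s, ringHom (ev s) a = φ s)
    (hinj : ∀ a b : A, (∀ s, ringHom (ev s) a = ringHom (ev s) b) → a = b) : IsVNRegular A := by
  have h : ∀ a : K, ∃ x : K, a = a ^ 2 * x := by
    intro a
    by_cases ha : a = 0
    · exact ⟨0, by simp [ha]⟩
    · obtain ⟨x, hx⟩ := hK.mul_inv_cancel ha
      exact ⟨x, by rw [pow_two, mul_assoc, hx, mul_one]⟩
  intro a
  choose x hx using fun s => h (ringHom (ev s) a)
  obtain ⟨b, hb⟩ := hsurj x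
  exact ⟨b, hinj _ _ fun s => by rw [map_mul, map_pow, hb, ← hx]⟩

theorem IsVNRegular.pi (K : CInfRingCat.{u}) (hK : IsCInfField K) (S : Type u) :
    IsVNRegular (of (S → K)) :=
  IsVNRegular.of_evals hK (fun s => CInfHom.mk (fun φ => φ s) fun _ _ => rfl)
    (fun φ => ⟨φ, fun _ => rfl⟩) (fun _ _ h => funext h)

theorem IsVNRegular.kHat (K : CInfRingCat.{u}) (hK : IsCInfField K) (X : Type u)
    [TopologicalSpace X] : IsVNRegular (of (KHatRing K X)) :=
  IsVNRegular.of_exists fun a => by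
    obtain ⟨R, φ, h⟩ := DirectLimit.exists_eq_mk _ a
    exact ⟨of (KHatStage K X R), CInfRing.toDirectLimit (kHatTransition K X) R,
      IsVNRegular.pi K hK _, φ, h.symm⟩

end CInfRingCat

/-- The contravariant functor `k̂` from Boolean spaces to von Neumann regular `C^∞`-rings,
sending `X` to `A_X`. -/
def kHat (K : CInfRingCat.{u}) (hK : K.IsCInfField) : Profinite.{u}ᵒᵖ ⥤ CInfVNRing.{u} where
  obj X := ⟨CInfRingCat.of (KHatRing K X.unop), CInfRingCat.IsVNRegular.kHat K hK _⟩
  map g := ObjectProperty.homMk (kHatMap K g.unop.hom.hom)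
  map_id X := by
    apply ObjectProperty.hom_ext
    refine CInfHom.ext (funext fun a => ?_)
    obtain ⟨R, φ, rfl⟩ := DirectLimit.exists_eq_mk _ a
    refine Quotient.sound ⟨R, le_rfl, le_rfl, ?_⟩
    funext q
    induction q using Quotient.inductionOn
    rfl
  map_comp g g' := by
    apply ObjectProperty.hom_ext
    refine CInfHom.ext (funext fun a => ?_)
    obtain ⟨R, φ, rfl⟩ := DirectLimit.exists_eq_mk _ a
    refine Quotient.sound ⟨OrderDual.toDual
      (((OrderDual.ofDual R).comap g.unop.hom.hom).comap g'.unop.hom.hom), le_rfl, le_rfl, ?_⟩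
    funext q
    induction q using Quotient.inductionOn
    rfl

/-- The covariant functor `Ǩ = k̂ ∘ Stone` from Boolean algebras to von Neumann regular
`C^∞`-rings. -/
def kCheck (K : CInfRingCat.{u}) (hK : K.IsCInfField) : BoolAlg.{u} ⥤ CInfVNRing.{u} :=
  stone ⋙ kHat K hK

/-- The structure map `K → A_X` making `A_X` a `K`-algebra: `c` goes to the class of the constant
functions with value `c`. -/
def kHatStructureMap (K : CInfRingCat.{u}) (X : Type u) [TopologicalSpace X] :
    K ⟶ CInfRingCat.of (KHatRing K X) :=
  CInfHom.comp (CInfRing.toDirectLimit (kHatTransition K X) (OrderDual.toDual ⊤))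
    (CInfHom.mk (fun c _ => c) fun _ _ => rfl)

/-- A functor `F : C ⥤ D` is full up to conjugation if every morphism of `D` becomes, after
conjugation with isomorphisms, the image of a morphism of `C`. -/
def FullUpToConjugation {C D : Type*} [Category C] [Category D] (F : C ⥤ D) : Prop :=
  ∀ ⦃d d' : D⦄ (φ : d ⟶ d'), ∃ (c c' : C) (f : c ⟶ c') (ψ : d ≅ F.obj c) (ψ' : d' ≅ F.obj c'),
    φ = ψ.hom ≫ F.map f ≫ ψ'.inv

end

/-!
The ring `A_X` is the `C^∞`-ring of locally constant functions `X → K`: evaluation at the points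
of `X` is jointly injective (`kHatEval_injective`), the values of an element form a locally constant
function (`isLocallyConstant_kHatEval`), and every locally constant function arises
(`kHatEval_ofLocallyConstant`). Compactness of `X` plays no part in this.

As `K` is a field, an idempotent of `A_X` takes only the values `0` and `1`, hence is the indicator
function of a clopen subset of `X`. For `X` the Stone space of `B`, the clopen subsets are the sets
`basic b` for a unique `b : B` (Stone's representation theorem: `basic_subset_basic_iff` rests on
the prime ideal theorem, `exists_eq_basic` on compactness). So `b ↦ indicator of basic b` is an
isomorphism from `B` to the idempotents of `Ǩ(B)`. It is natural because the map induced by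
`g : X → Y` is precomposition with `g` (`kHatEval_kHatMap`) and the preimage of `basic b` under
`comap h` is `basic (h b)`. Faithfulness, fullness up to conjugation and density are formal
consequences of this natural isomorphism, and the structure maps `K → Ǩ(B)` are natural because
precomposition preserves constant functions.
-/

noncomputable section

/-! ### Elements of `A_X` as locally constant functions -/

section Evaluation

variable (K : CInfRingCat.{u}) {X Y : Type u} [TopologicalSpace X] [TopologicalSpace Y]

/-- The `C^∞`-ring `A_X` as an object of the category of `C^∞`-rings. This is not an abbreviation:
the reducible `CInfRingCat.of (KHatRing K X)` has carrier `KHatRing K X`, which would hide the ring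
structure from instance search. -/
def KHatCat (K : CInfRingCat.{u}) (X : Type u) [TopologicalSpace X] : CInfRingCat.{u} :=
  CInfRingCat.of (KHatRing K X)

/-- Evaluation of the elements of `A_X` at a point `x`; on the stage of `R` it is the evaluation
`K^(X/R) → K` at the class of `x`. -/
def kHatEval (x : X) : KHatCat K X ⟶ K :=
  CInfRing.directLimitDesc (kHatTransition K X)
    (fun R => CInfHom.mk (fun φ => φ ((OrderDual.ofDual R).proj x)) fun _ _ => rfl)
    (fun _ _ _ _ => rfl)

theorem kHatEval_injective {a b : KHatCat K X}
    (h : ∀ x, CInfRingCat.ringHom (kHatEval K x) a = CInfRingCat.ringHom (kHatEval K x) b) :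
    a = b := by
  obtain ⟨R, φ, rfl⟩ := DirectLimit.exists_eq_mk _ a
  obtain ⟨S, ψ, rfl⟩ := DirectLimit.exists_eq_mk _ b
  obtain ⟨T, hR, hS⟩ := exists_ge_ge R S
  refine Quotient.sound ⟨T, hR, hS, ?_⟩
  funext q
  induction q using Quotient.inductionOn with
  | _ x => exact h x

theorem isLocallyConstant_kHatEval (a : KHatCat K X) :
    IsLocallyConstant fun x => CInfRingCat.ringHom (kHatEval K x) a := by
  obtain ⟨R, φ, rfl⟩ := DirectLimit.exists_eq_mk _ a
  exact (OrderDual.ofDual R).proj_isLocallyConstant.comp φ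

/-- The element of `A_X` given by a locally constant function, which factors through the quotient
of `X` by the relation of having equal values. -/
def kHatOfLocallyConstant (f : LocallyConstant X K) : KHatCat K X :=
  (⟦⟨OrderDual.toDual f.discreteQuotient, f.lift⟩⟧ : KHatRing K X)

theorem kHatEval_ofLocallyConstant (f : LocallyConstant X K) (x : X) :
    CInfRingCat.ringHom (kHatEval K x) (kHatOfLocallyConstant K f) = f x :=
  rfl

theorem kHatEval_kHatMap (g : C(X, Y)) (x : X) (a : KHatCat K Y) :
    CInfRingCat.ringHom (kHatEval K x) (kHatMap K g a) =
      CInfRingCat.ringHom (kHatEval K (g x)) a := by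
  obtain ⟨R, φ, rfl⟩ := DirectLimit.exists_eq_mk _ a
  rfl

open scoped Classical in
/-- The element of `A_X` given by the indicator function of a clopen subset of `X`. -/
def kHatIndicator {C : Set X} (hC : IsClopen C) : KHatCat K X :=
  kHatOfLocallyConstant K
    ⟨fun x => if x ∈ C then 1 else 0,
      (DiscreteQuotient.ofIsClopen hC).proj_isLocallyConstant.comp
        fun q => if Quotient.liftOn q (· ∈ C) (fun _ _ h => propext h) then 1 else 0⟩

open scoped Classical in
theorem kHatEval_indicator {C : Set X} (hC : IsClopen C) (x : X) :
    CInfRingCat.ringHom (kHatEval K x) (kHatIndicator K hC) = if x ∈ C then 1 else 0 :=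
  kHatEval_ofLocallyConstant K _ x

theorem isIdempotentElem_kHatIndicator {C : Set X} (hC : IsClopen C) :
    IsIdempotentElem (kHatIndicator K hC) := by
  refine kHatEval_injective K fun x => ?_
  simp only [map_mul, kHatEval_indicator]
  split_ifs <;> simp

variable {K}

theorem exists_eq_kHatIndicator (hK : K.IsCInfField) {e : KHatCat K X}
    (he : IsIdempotentElem e) : ∃ (C : Set X) (hC : IsClopen C), e = kHatIndicator K hC := by
  refine ⟨_, (isLocallyConstant_kHatEval K e).isClopen_fiber 1,
    kHatEval_injective K fun x => ?_⟩
  rw [kHatEval_indicator]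
  split_ifs with h
  · exact h
  · have := hK.isDomain
    exact (IsIdempotentElem.iff_eq_zero_or_one.1
      (he.map (CInfRingCat.ringHom (kHatEval K x)))).resolve_right h

theorem kHatIndicator_mul_eq_left_iff (hK : K.IsCInfField) {C D : Set X} (hC : IsClopen C)
    (hD : IsClopen D) :
    kHatIndicator K hC * kHatIndicator K hD = kHatIndicator K hC ↔ C ⊆ D := by
  have := hK.nontrivial
  constructor
  · intro h x hx
    by_contra hx'
    have := congrArg (CInfRingCat.ringHom (kHatEval K x)) h
    simp [kHatEval_indicator, hx, hx'] at this
  · intro h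
    refine kHatEval_injective K fun x => ?_
    have := @h x
    simp only [map_mul, kHatEval_indicator]
    split_ifs <;> simp_all

theorem kHatMap_indicator (g : C(X, Y)) {C : Set Y} (hC : IsClopen C) :
    kHatMap K g (kHatIndicator K hC) = kHatIndicator K (hC.preimage g.continuous) :=
  kHatEval_injective K fun x => by
    rw [kHatEval_kHatMap, kHatEval_indicator, kHatEval_indicator]
    rfl

end Evaluation

/-! ### Stone's representation theorem -/

namespace BoolUltrafilter

variable {B : Type u} [BooleanAlgebra B]

theorem basic_bot : basic (⊥ : B) = ∅ :=
  Set.eq_empty_of_forall_notMem fun U => U.bot_notMem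

theorem basic_inf (a b : B) : basic (a ⊓ b) = basic a ∩ basic b :=
  Set.ext fun U => ⟨fun h => ⟨U.mem_of_le inf_le_left h, U.mem_of_le inf_le_right h⟩,
    fun h => U.inf_mem h.1 h.2⟩

theorem basic_compl (a : B) : basic aᶜ = (basic a)ᶜ :=
  Set.ext fun U => U.compl_mem_iff a

theorem basic_sup (a b : B) : basic (a ⊔ b) = basic a ∪ basic b := by
  rw [← compl_compl (a ⊔ b), compl_sup, basic_compl, basic_inf, basic_compl, basic_compl,
    Set.compl_inter, compl_compl, compl_compl]

/-- The complement of a prime ideal of a Boolean algebra is an ultrafilter. -/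
def ofIsPrime (I : Order.Ideal B) (hI : I.IsPrime) : BoolUltrafilter B where
  carrier := (I : Set B)ᶜ
  top_mem := hI.toIsProper.top_notMem
  inf_mem ha hb h := (hI.mem_or_mem h).elim ha hb
  mem_of_le hab ha hb := ha (I.lower hab hb)
  bot_notMem h := h I.bot_mem
  mem_or_compl_mem a := by
    by_contra! h
    simp only [Set.mem_compl_iff, not_not] at h
    exact hI.toIsProper.top_notMem (sup_compl_eq_top (x := a) ▸ Order.Ideal.sup_mem h.1 h.2)

theorem basic_subset_basic_iff {a b : B} : basic a ⊆ basic b ↔ a ≤ b := by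
  refine ⟨fun h => ?_, fun h U hU => U.mem_of_le h hU⟩
  by_contra hab
  obtain ⟨I, hI, hb, ha⟩ := DistribLattice.prime_ideal_of_disjoint_filter_ideal
    (F := Order.PFilter.principal a) (I := Order.Ideal.principal b)
    (Set.disjoint_left.2 fun c hac hcb => hab (le_trans hac hcb))
  have haU : ofIsPrime I hI ∈ basic a := Set.disjoint_left.1 ha (le_refl a)
  exact h haU (hb (le_refl b))

theorem isTopologicalBasis_range_basic :
    TopologicalSpace.IsTopologicalBasis (Set.range (basic (B := B))) := by
  refine TopologicalSpace.isTopologicalBasis_of_subbasis_of_finiteInter rfl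
    ⟨⟨⊤, Set.eq_univ_of_forall fun U => U.top_mem⟩, ?_⟩
  rintro _ ⟨a, rfl⟩ _ ⟨b, rfl⟩
  exact ⟨a ⊓ b, basic_inf a b⟩

theorem exists_eq_basic {C : Set (BoolUltrafilter B)} (hC : IsClopen C) : ∃ b, C = basic b := by
  obtain ⟨s, hs, rfl⟩ := eq_finite_iUnion_of_isTopologicalBasis_of_isCompact_open basic
    isTopologicalBasis_range_basic C hC.isClosed.isCompact hC.isOpen
  clear hC
  induction s, hs using Set.Finite.induction_on with
  | empty => exact ⟨⊥, by simp [basic_bot]⟩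
  | @insert a s _ _ ih =>
    obtain ⟨b, hb⟩ := ih
    exact ⟨a ⊔ b, by rw [Set.biUnion_insert, hb, basic_sup]⟩

end BoolUltrafilter

/-! ### The natural isomorphism between `B` and the idempotents of `Ǩ(B)` -/

section NaturalIso

variable (K : CInfRingCat.{u}) (hK : K.IsCInfField)

/-- The isomorphism from `B` to the Boolean algebra of idempotents of `Ǩ(B)`, sending `b` to the
indicator function of the set of ultrafilters that contain `b`. -/
def idempotentsKCheckOrderIso (B : Type u) [BooleanAlgebra B] :
    B ≃o {e : KHatCat K (BoolUltrafilter B) // IsIdempotentElem e} :=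
  RelIso.ofSurjective
    (OrderEmbedding.ofMapLEIff
      (fun b => ⟨kHatIndicator K (BoolUltrafilter.isClopen_basic b),
        isIdempotentElem_kHatIndicator K _⟩)
      fun a b => by
        rw [← inf_eq_left, ← BoolUltrafilter.basic_subset_basic_iff,
          ← kHatIndicator_mul_eq_left_iff hK (BoolUltrafilter.isClopen_basic a)
            (BoolUltrafilter.isClopen_basic b)]
        exact Subtype.ext_iff)
    fun e => by
      obtain ⟨C, hC, h⟩ := exists_eq_kHatIndicator hK e.2
      obtain ⟨b, rfl⟩ := BoolUltrafilter.exists_eq_basic hC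
      exact ⟨b, Subtype.ext h.symm⟩

/-- The natural isomorphism `B ≅ B̃(Ǩ(B))`. -/
def idempotentsKCheckIso : 𝟭 BoolAlg.{u} ≅ kCheck K hK ⋙ idempotentsVN.{u} :=
  NatIso.ofComponents (fun B => BoolAlg.Iso.mk (idempotentsKCheckOrderIso K hK B)) fun h => by
    ext b
    exact Subtype.ext (kHatMap_indicator (K := K)
      ⟨_, BoolUltrafilter.continuous_comap h.hom⟩ (BoolUltrafilter.isClopen_basic b)).symm

/-- The structure maps `K → Ǩ(B)`, as a natural transformation from a constant functor. -/
def kCheckStructureMap :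
    (Functor.const BoolAlg.{u}).obj K ⟶ kCheck K hK ⋙ CInfRingCat.IsVNRegular.ι where
  app B := kHatStructureMap K (BoolUltrafilter B)
  naturality _ _ h := CInfHom.ext <| funext fun c =>
    kHatEval_injective K fun U => (kHatEval_kHatMap K
      ⟨_, BoolUltrafilter.continuous_comap h.hom⟩ U (CInfHom.toFun (kHatStructureMap K _) c)).symm

end NaturalIso

end

theorem theorem4 (K : CInfRingCat.{u}) (hK : K.IsCInfField) :
    (∃ θ : 𝟭 BoolAlg.{u} ≅ kCheck K hK ⋙ idempotentsVN.{u},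
      ∀ ⦃B B' : BoolAlg.{u}⦄ (h : B ⟶ B'),
        h = θ.hom.app B ≫ idempotentsVN.map ((kCheck K hK).map h) ≫ θ.inv.app B') ∧
    (kCheck K hK).Faithful ∧
    FullUpToConjugation idempotentsVN.{u} ∧
    idempotentsVN.{u}.EssSurj ∧
    (∃ κ : (Functor.const BoolAlg.{u}).obj K ⟶ kCheck K hK ⋙ CInfRingCat.IsVNRegular.ι,
      ∀ B : BoolAlg.{u}, κ.app B = kHatStructureMap K (BoolUltrafilter B)) ∧
    (∀ B : BoolAlg.{u}, Nonempty (idempotentsVN.obj ((kCheck K hK).obj B) ≅ B)) := by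
  set θ := idempotentsKCheckIso K hK
  have conj : ∀ ⦃B B' : BoolAlg.{u}⦄ (h : B ⟶ B'),
      h = θ.hom.app B ≫ idempotentsVN.map ((kCheck K hK).map h) ≫ θ.inv.app B' :=
    fun _ _ h => (NatIso.naturality_1 θ.symm h).symm
  refine ⟨⟨θ, conj⟩, ⟨fun {_ _} f g hfg => ?_⟩, fun B B' φ => ?_, ⟨fun B => ?_⟩,
    ⟨kCheckStructureMap K hK, fun _ => rfl⟩, fun B => ⟨(θ.app B).symm⟩⟩
  · rw [conj f, hfg, ← conj g]
  · exact ⟨_, _, (kCheck K hK).map φ, θ.app B, θ.app B', conj φ⟩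
  · exact ⟨_, ⟨(θ.app B).symm⟩⟩
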